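/- Let $\beta=(1-\sqrt5)/2$, let $(L_n)_{n\ge0}$ be the Lucas numbers ($L_0=2$, $L_1=1$, $L_n=L_{n-1}+L_{n-2}$ for $n\ge 2$), and let $$\mathrm{Li}_2(z)=\sum_{k\ge1}\frac{z^k}{k^2}\quad(|z|<1),\qquad \mathrm{Cl}_2(y)=\sum_{n\ge1}\frac{\sin(ny)}{n^2}\quad(y\in\mathbb R)$$ be the dilogarithm and Clausen's function. If $r$ is a positive even integer, then (the integrands being integrable on $[0,\pi]$) $$\begin{aligned}\int_0^\pi\frac{x^2\cos x}{L_r^2-4\cos^2(2x)}\,dx={}&-\frac{\pi}{2L_r}\frac{\sqrt{\beta^r}}{1-\beta^r}\left(\mathrm{Li}_2(\sqrt{\beta^r})-\mathrm{Li}_2(-\sqrt{\beta^r})\right)\\&-\frac{\pi}{2L_r}\frac{\sqrt{\beta^r}}{1+\beta^r}\left(\mathrm{Cl}_2(2\arctan\sqrt{\beta^r})+\mathrm{Cl}_2(\pi-2\arctan\sqrt{\beta^r})\right)\\&-\frac{\pi}{L_r}\frac{\sqrt{\beta^r}}{1+\beta^r}\arctan(\sqrt{\beta^r})\ln(\sqrt{\beta^r})\end{aligned}$$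 and $$\begin{aligned}\int_0^\pi\frac{x^2\cos(3x)}{L_r^2-4\cos^2(2x)}\,dx={}&\left(\frac1{L_r}-1\right)\frac{\pi}{2}\frac{\sqrt{\beta^r}}{1-\beta^r}\left(\mathrm{Li}_2(\sqrt{\beta^r})-\mathrm{Li}_2(-\sqrt{\beta^r})\right)\\&+\left(\frac1{L_r}+1\right)\frac{\pi}{2}\frac{\sqrt{\beta^r}}{1+\beta^r}\left(\mathrm{Cl}_2(2\arctan\sqrt{\beta^r})+\mathrm{Cl}_2(\pi-2\arctan\sqrt{\beta^r})\right)\\&+\left(\frac1{L_r}+1\right)\frac{\pi\sqrt{\beta^r}}{1+\beta^r}\arctan(\sqrt{\beta^r})\ln(\sqrt{\beta^r}).\end{aligned}$$ -/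

import Mathlib

open Real intervalIntegral MeasureTheory

/-- The Lucas numbers `L 0 = 2`, `L 1 = 1`, `L (n + 2) = L (n + 1) + L n`. -/
def lucas : ℕ → ℕ
  | 0 => 2
  | 1 => 1
  | n + 2 => lucas (n + 1) + lucas n

/-- The dilogarithm `Li₂ z = ∑_{k ≥ 1} z ^ k / k ^ 2` of a real number `z` with `|z| ≤ 1`. -/
noncomputable def dilog (z : ℝ) : ℝ := ∑' k : ℕ, z ^ (k + 1) / ((k : ℝ) + 1) ^ 2

/-- Clausen's function `Cl₂ y = ∑_{n ≥ 1} sin (n y) / n ^ 2`. -/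
noncomputable def clausen (y : ℝ) : ℝ := ∑' n : ℕ, sin (((n : ℝ) + 1) * y) / ((n : ℝ) + 1) ^ 2

theorem summable_one_div_succ_sq : Summable fun k : ℕ => 1 / ((k : ℝ) + 1) ^ 2 := by
  have h := (summable_nat_add_iff 1).2 (Real.summable_one_div_nat_pow.2 one_lt_two)
  simpa using h

/-- The series that defines the dilogarithm converges for `|z| ≤ 1`. -/
theorem hasSum_dilog {z : ℝ} (hz : |z| ≤ 1) :
    HasSum (fun k : ℕ => z ^ (k + 1) / ((k : ℝ) + 1) ^ 2) (dilog z) := by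
  refine (Summable.of_norm_bounded summable_one_div_succ_sq fun k => ?_).hasSum
  rw [norm_div, norm_pow, norm_pow, Real.norm_eq_abs, Real.norm_eq_abs,
    abs_of_nonneg (by positivity : (0 : ℝ) ≤ (k : ℝ) + 1)]
  gcongr
  exact pow_le_one₀ (abs_nonneg z) hz

/-- The series that defines Clausen's function converges everywhere. -/
theorem hasSum_clausen (y : ℝ) :
    HasSum (fun n : ℕ => sin (((n : ℝ) + 1) * y) / ((n : ℝ) + 1) ^ 2) (clausen y) := by
  refine (Summable.of_norm_bounded summable_one_div_succ_sq fun k => ?_).hasSum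
  rw [norm_div, norm_pow, Real.norm_eq_abs, Real.norm_eq_abs,
    abs_of_nonneg (by positivity : (0 : ℝ) ≤ (k : ℝ) + 1)]
  gcongr
  exact Real.abs_sin_le_one _

/-!
Put `q = β ^ r = s ^ 2`, so that `0 < q < 1` and, `r` being even, `L = q + 1 / q`. Partial
fractions split both integrands into multiples of `x ^ 2 * cos x / (1 ∓ 2 q cos 2x + q ^ 2)`;
the second one first needs `cos 3x = (2 cos 2x - 1) cos x`. The cosine expansion
`(1 - q) cos x / (1 - 2 q cos 2x + q ^ 2) = ∑ q ^ n cos ((2n + 1) x)` (`hasSum_pow_mul_cos_odd`)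
and `∫₀^π x ^ 2 cos ((2n + 1) x) dx = -2π / (2n + 1) ^ 2` then turn the two integrals into
`∑ q ^ n / (2n + 1) ^ 2` and `∑ (-q) ^ n / (2n + 1) ^ 2`.

The first series is the odd part of the dilogarithm at `s`. The second is `Ti₂ s / s`, where `Ti₂`
is the inverse tangent integral, and `invTanIntegral_eq` expresses `Ti₂` by Clausen's function.
Both sides of that formula vanish at `0`, and they have the same derivative by
`hasDerivAt_clausen_odd`, whose proof is an Abel summation of the Fourier series of `log tan`.
-/

/-! ### Odd-indexed parts of series -/

theorem hasSum_even_of_hasSum_alternating {f : ℕ → ℝ} {a b : ℝ} (ha : HasSum f a)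
    (hb : HasSum (fun n => (-1) ^ n * f n) b) : HasSum (fun n => f (2 * n)) ((a + b) / 2) := by
  have hinj : Function.Injective fun n : ℕ => 2 * n := fun m n h => by simpa using h
  have h := (ha.add hb).div_const 2
  rw [← hinj.hasSum_iff] at h
  · refine h.congr_fun fun n => ?_
    simp [pow_mul]
  · intro n hn
    have hodd : Odd n := by
      rw [← Nat.not_even_iff_odd]
      rintro ⟨m, rfl⟩
      exact hn ⟨m, by ring⟩
    simp [hodd.neg_one_pow]

theorem summable_one_div_odd_sq : Summable fun n : ℕ => 1 / (2 * (n : ℝ) + 1) ^ 2 := by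
  refine Summable.of_nonneg_of_le (fun n => by positivity) (fun n => ?_) summable_one_div_succ_sq
  gcongr
  linarith [(Nat.cast_nonneg n : (0 : ℝ) ≤ n)]

theorem hasSum_dilog_odd {s : ℝ} (hs : |s| ≤ 1) :
    HasSum (fun n : ℕ => s ^ (2 * n + 1) / (2 * (n : ℝ) + 1) ^ 2)
      ((dilog s - dilog (-s)) / 2) := by
  have h := hasSum_even_of_hasSum_alternating (hasSum_dilog hs)
    (b := -dilog (-s)) ((hasSum_dilog (z := -s) (by simpa using hs)).neg.congr_fun fun n => by
      rw [neg_pow s, pow_succ (-1 : ℝ)]; ring)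
  convert h using 1
  · push_cast
    rfl
  · ring

theorem hasSum_clausen_odd (y : ℝ) :
    HasSum (fun n : ℕ => sin ((2 * (n : ℝ) + 1) * y) / (2 * (n : ℝ) + 1) ^ 2)
      ((clausen y + clausen (π - y)) / 2) := by
  have h := hasSum_even_of_hasSum_alternating (hasSum_clausen y)
    (b := clausen (π - y)) ((hasSum_clausen (π - y)).congr_fun fun n => by
      have : ((n : ℝ) + 1) * (π - y) = ((n + 1 : ℕ) : ℝ) * π - ((n : ℝ) + 1) * y := by
        push_cast; ring
      rw [this, sin_nat_mul_pi_sub, pow_succ]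
      ring)
  convert h using 2
  push_cast
  ring

/-- The real part of the expansion `artanh z = ∑ z ^ (2 n + 1) / (2 n + 1)` at `z = t * exp (i y)`. -/
theorem hasSum_pow_mul_cos_odd_div {t : ℝ} (ht : |t| < 1) (y : ℝ) :
    HasSum (fun n : ℕ => t ^ (2 * n + 1) * cos ((2 * (n : ℝ) + 1) * y) / (2 * (n : ℝ) + 1))
      ((log (1 + 2 * t * cos y + t ^ 2) - log (1 - 2 * t * cos y + t ^ 2)) / 4) := by
  have key : ∀ u : ℝ, |u| < 1 → HasSum
      (fun n : ℕ => u ^ (n + 1) * cos (((n : ℝ) + 1) * y) / ((n : ℝ) + 1))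
      (-log (1 - 2 * u * cos y + u ^ 2) / 2) := by
    intro u hu
    set z : ℂ := u * Complex.exp (y * Complex.I) with hz
    have hnorm : ‖z‖ < 1 := by
      rw [hz, norm_mul, Complex.norm_exp_ofReal_mul_I]; simpa using hu
    have h := Complex.hasSum_re (Complex.hasSum_taylorSeries_neg_log' hnorm)
    convert h using 1
    · ext n
      have hpow : z ^ (n + 1) = ((u ^ (n + 1) : ℝ) : ℂ) *
          Complex.exp ((((n : ℝ) + 1) * y : ℝ) * Complex.I) := by
        rw [hz, mul_pow, ← Complex.exp_nat_mul]
        push_cast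
        ring_nf
      have hcast : ((n : ℂ) + 1) = (((n : ℝ) + 1 : ℝ) : ℂ) := by push_cast; rfl
      rw [hpow, hcast, Complex.div_ofReal_re, Complex.re_ofReal_mul, Complex.exp_ofReal_mul_I_re]
    · have hsq : 1 - 2 * u * cos y + u ^ 2 = ‖1 - z‖ ^ 2 := by
        rw [← Complex.normSq_eq_norm_sq, Complex.normSq_apply]
        simp only [hz, Complex.sub_re, Complex.sub_im, Complex.one_re, Complex.one_im,
          Complex.re_ofReal_mul, Complex.im_ofReal_mul, Complex.exp_ofReal_mul_I_re,
          Complex.exp_ofReal_mul_I_im]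
        linear_combination (-u ^ 2) * sin_sq_add_cos_sq y
      rw [hsq, log_pow, Complex.neg_re, Complex.log_re]
      push_cast
      ring
  have h := hasSum_even_of_hasSum_alternating (key t ht)
    (b := log (1 + 2 * t * cos y + t ^ 2) / 2) (by
      have h := (key (-t) (by simpa using ht)).neg
      rw [show -(-log (1 - 2 * -t * cos y + (-t) ^ 2) / 2) =
        log (1 + 2 * t * cos y + t ^ 2) / 2 by ring_nf] at h
      exact h.congr_fun fun n => by
        rw [neg_pow t, pow_succ (-1 : ℝ)]; ring)
  convert h using 1
  · ext n
    push_cast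
    ring
  · ring

/-! ### The inverse tangent integral -/

/-- By `hasSum_clausen_odd` the function is `∑ sin ((2 n + 1) y) / (2 n + 1) ^ 2`. The differentiated
series converges only conditionally, so its terms are damped by `t ^ (2 n + 1)`, with `t → 1`. -/
theorem hasDerivAt_clausen_odd {y : ℝ} (hy : y ∈ Set.Ioo 0 π) :
    HasDerivAt (fun y => (clausen y + clausen (π - y)) / 2) (-log (tan (y / 2)) / 2) y := by
  set F : ℝ → ℝ → ℝ := fun t y =>
    ∑' n : ℕ, t ^ (2 * n + 1) * sin ((2 * (n : ℝ) + 1) * y) / (2 * (n : ℝ) + 1) ^ 2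
  set G : ℝ → ℝ → ℝ := fun t y =>
    (log (1 + 2 * t * cos y + t ^ 2) - log (1 - 2 * t * cos y + t ^ 2)) / 4 with hG
  have hmem : ∀ᶠ t : ℝ in nhdsWithin 1 (Set.Iio 1), t ∈ Set.Ioo (0 : ℝ) 1 :=
    Ioo_mem_nhdsLT one_pos
  have hderiv : ∀ t ∈ Set.Ioo (0 : ℝ) 1, ∀ x, HasDerivAt (F t) (G t x) x := by
    intro t ht x
    have habs : |t| < 1 := by rw [abs_of_pos ht.1]; exact ht.2
    have hval : G t x = ∑' n : ℕ,
        t ^ (2 * n + 1) * cos ((2 * (n : ℝ) + 1) * x) / (2 * (n : ℝ) + 1) :=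
      (hasSum_pow_mul_cos_odd_div habs x).tsum_eq.symm
    rw [hval]
    refine hasDerivAt_tsum (u := fun n : ℕ => t ^ n) (y₀ := 0)
      (g := fun n y => t ^ (2 * n + 1) * sin ((2 * (n : ℝ) + 1) * y) / (2 * (n : ℝ) + 1) ^ 2)
      (g' := fun n y => t ^ (2 * n + 1) * cos ((2 * (n : ℝ) + 1) * y) / (2 * (n : ℝ) + 1))
      (summable_geometric_of_lt_one ht.1.le ht.2) (fun n x => ?_) (fun n x => ?_) ?_ x
    · have h := (((hasDerivAt_id x).const_mul (2 * (n : ℝ) + 1)).sin.const_mul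
        (t ^ (2 * n + 1))).div_const ((2 * (n : ℝ) + 1) ^ 2)
      refine h.congr_deriv ?_
      simp only [id]
      field_simp
    · rw [norm_div, norm_mul, norm_pow, norm_of_nonneg ht.1.le,
        norm_of_nonneg (by positivity : (0 : ℝ) ≤ 2 * (n : ℝ) + 1)]
      have h1 : t ^ (2 * n + 1) ≤ t ^ n := pow_le_pow_of_le_one ht.1.le ht.2.le (by omega)
      have h2 : ‖cos ((2 * (n : ℝ) + 1) * x)‖ ≤ 1 := abs_cos_le_one _
      refine div_le_of_le_mul₀ (by positivity) (pow_nonneg ht.1.le _) ?_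
      have h3 : (1 : ℝ) ≤ 2 * (n : ℝ) + 1 := by linarith [(Nat.cast_nonneg n : (0 : ℝ) ≤ n)]
      have h4 := pow_nonneg ht.1.le n
      calc _ ≤ t ^ n * 1 := by gcongr
        _ ≤ _ := by gcongr
    · simp
  have htend : ∀ x, Filter.Tendsto (fun t => F t x) (nhdsWithin 1 (Set.Iio 1))
      (nhds ((clausen x + clausen (π - x)) / 2)) := by
    intro x
    rw [← (hasSum_clausen_odd x).tsum_eq]
    refine tendsto_tsum_of_dominated_convergence summable_one_div_odd_sq (fun n => ?_) ?_
    · have hc : Continuous fun t : ℝ =>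
          t ^ (2 * n + 1) * sin ((2 * (n : ℝ) + 1) * x) / (2 * (n : ℝ) + 1) ^ 2 := by fun_prop
      simpa using (hc.tendsto 1).mono_left nhdsWithin_le_nhds
    · filter_upwards [hmem] with t ht n
      rw [norm_div, norm_mul, norm_pow, norm_of_nonneg ht.1.le,
        norm_of_nonneg (by positivity : (0 : ℝ) ≤ (2 * (n : ℝ) + 1) ^ 2)]
      gcongr
      exact mul_le_one₀ (pow_le_one₀ ht.1.le ht.2.le) (norm_nonneg _) (abs_sin_le_one _)
  have hcos : cos y = 2 * cos (y / 2) ^ 2 - 1 := by rw [← cos_two_mul]; ring_nf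
  have hc : 0 < cos (y / 2) := cos_pos_of_mem_Ioo ⟨by linarith [hy.1, hy.2], by linarith [hy.2]⟩
  have hs : 0 < sin (y / 2) := sin_pos_of_pos_of_lt_pi (by linarith [hy.1]) (by linarith [hy.1, hy.2])
  have hsc := sin_sq_add_cos_sq (y / 2)
  have hplus : 1 + 2 * 1 * cos y + 1 ^ 2 = (2 * cos (y / 2)) ^ 2 := by rw [hcos]; ring
  have hminus : 1 - 2 * 1 * cos y + 1 ^ 2 = (2 * sin (y / 2)) ^ 2 := by
    rw [hcos]; linear_combination (-4) * hsc
  have hGcont : ContinuousAt (fun p : ℝ × ℝ => G p.1 p.2) (1, y) := by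
    have h1 : ContinuousAt (fun p : ℝ × ℝ => 1 + 2 * p.1 * cos p.2 + p.1 ^ 2) (1, y) := by fun_prop
    have h2 : ContinuousAt (fun p : ℝ × ℝ => 1 - 2 * p.1 * cos p.2 + p.1 ^ 2) (1, y) := by fun_prop
    refine ((h1.log ?_).sub (h2.log ?_)).div_const 4
    · simp only [hplus]; positivity
    · simp only [hminus]; positivity
  have hval : G 1 y = -log (tan (y / 2)) / 2 := by
    simp only [hG]
    rw [hplus, hminus, log_pow, log_pow, log_mul two_ne_zero hc.ne', log_mul two_ne_zero hs.ne',
      tan_eq_sin_div_cos, log_div hs.ne' hc.ne']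
    push_cast
    ring
  rw [← hval]
  refine hasDerivAt_of_tendstoUniformlyOnFilter (l := nhdsWithin 1 (Set.Iio 1)) (f := F)
    (f' := G) (g' := G 1) ?_ ?_ (.of_forall htend)
  · -- Joint continuity of `G` at `(1, y)` is all the uniformity that is needed.
    rw [tendstoUniformlyOnFilter_iff_tendsto]
    have hle : nhdsWithin (1 : ℝ) (Set.Iio 1) ×ˢ nhds y ≤ nhds ((1 : ℝ), y) := by
      rw [nhds_prod_eq]; exact Filter.prod_mono nhdsWithin_le_nhds le_rfl
    have ha : Filter.Tendsto (fun p : ℝ × ℝ => G 1 p.2)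
        (nhdsWithin (1 : ℝ) (Set.Iio 1) ×ˢ nhds y) (nhds (G 1 y)) := by
      have : ContinuousAt (fun p : ℝ × ℝ => G 1 p.2) (1, y) :=
        ContinuousAt.comp (g := fun p : ℝ × ℝ => G p.1 p.2)
          (f := fun p : ℝ × ℝ => ((1 : ℝ), p.2)) hGcont (by fun_prop)
      exact this.tendsto.mono_left hle
    exact ((ha.prodMk_nhds (hGcont.tendsto.mono_left hle))).mono_right (nhds_le_uniformity _)
  · rw [Filter.eventually_prod_iff]
    exact ⟨_, hmem, fun _ => True, by simp, fun ht x _ => hderiv _ ht _⟩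

theorem continuous_clausen : Continuous clausen := by
  refine continuous_tsum (fun n => by fun_prop) summable_one_div_succ_sq fun n y => ?_
  rw [norm_div, norm_of_nonneg (by positivity : (0 : ℝ) ≤ ((n : ℝ) + 1) ^ 2)]
  gcongr
  exact abs_sin_le_one _

/-- The inverse tangent integral `Ti₂ s = ∑ (-1) ^ n s ^ (2 n + 1) / (2 n + 1) ^ 2`. -/
noncomputable def invTanIntegral (s : ℝ) : ℝ :=
  ∑' n : ℕ, (-1) ^ n * s ^ (2 * n + 1) / (2 * (n : ℝ) + 1) ^ 2

theorem continuousOn_invTanIntegral : ContinuousOn invTanIntegral (Set.Icc (-1) 1) := by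
  refine continuousOn_tsum (fun n => by fun_prop) summable_one_div_odd_sq fun n s hs => ?_
  rw [norm_div, norm_mul, norm_pow, norm_pow, norm_neg, norm_one, one_pow, one_mul,
    norm_of_nonneg (by positivity : (0 : ℝ) ≤ (2 * (n : ℝ) + 1) ^ 2)]
  gcongr
  exact pow_le_one₀ (norm_nonneg _) (abs_le.2 hs)

theorem hasDerivAt_invTanIntegral {s : ℝ} (hs : |s| < 1) (h0 : s ≠ 0) :
    HasDerivAt invTanIntegral (arctan s / s) s := by
  obtain ⟨ρ, hρ, hρ1⟩ := exists_between hs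
  have hρ0 : 0 < ρ := (abs_nonneg s).trans_lt hρ
  have hsum : HasSum (fun n : ℕ => (-1) ^ n * s ^ (2 * n) / (2 * (n : ℝ) + 1)) (arctan s / s) := by
    refine ((Real.hasSum_arctan hs).div_const s).congr_fun fun n => ?_
    push_cast
    field_simp
    ring
  rw [← hsum.tsum_eq]
  refine hasDerivAt_tsum_of_isPreconnected (u := fun n : ℕ => ρ ^ n) (y₀ := 0)
    (g := fun n s => (-1) ^ n * s ^ (2 * n + 1) / (2 * (n : ℝ) + 1) ^ 2)
    (g' := fun n s => (-1) ^ n * s ^ (2 * n) / (2 * (n : ℝ) + 1))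
    (t := Set.Ioo (-ρ) ρ) (summable_geometric_of_lt_one hρ0.le hρ1) isOpen_Ioo isPreconnected_Ioo
    (fun n x _ => ?_) (fun n x hx => ?_) ⟨by linarith, hρ0⟩ ?_ (abs_lt.1 hρ)
  · have h := ((hasDerivAt_pow (2 * n + 1) x).const_mul ((-1 : ℝ) ^ n)).div_const
      ((2 * (n : ℝ) + 1) ^ 2)
    refine h.congr_deriv ?_
    rw [Nat.add_sub_cancel]
    push_cast
    field_simp
  · rw [norm_div, norm_mul, norm_pow, norm_pow, norm_neg, norm_one, one_pow, one_mul,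
      norm_of_nonneg (by positivity : (0 : ℝ) ≤ 2 * (n : ℝ) + 1)]
    have h1 : (1 : ℝ) ≤ 2 * (n : ℝ) + 1 := by linarith [(Nat.cast_nonneg n : (0 : ℝ) ≤ n)]
    calc ‖x‖ ^ (2 * n) / (2 * (n : ℝ) + 1) ≤ ‖x‖ ^ (2 * n) := div_le_self (by positivity) h1
      _ ≤ ρ ^ (2 * n) := by gcongr; exact (abs_lt.2 hx).le
      _ ≤ ρ ^ n := pow_le_pow_of_le_one hρ0.le hρ1.le (by omega)
  · simp

theorem abs_arctan_le_abs (s : ℝ) : |arctan s| ≤ |s| := by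
  have h := (convex_univ (𝕜 := ℝ) (E := ℝ)).norm_image_sub_le_of_norm_hasDerivWithin_le (C := 1)
    (fun x _ => (hasDerivAt_arctan x).hasDerivWithinAt) (fun x _ => ?_)
    (Set.mem_univ 0) (Set.mem_univ s)
  · simpa using h
  · rw [norm_of_nonneg (by positivity)]
    exact div_le_one_of_le₀ (by nlinarith [sq_nonneg x]) (by positivity)

/-- The singularity of `log` at `0` is cancelled by the zero of `arctan`. -/
theorem continuous_arctan_mul_log : Continuous fun s => arctan s * log s := by
  refine continuous_iff_continuousAt.2 fun s => ?_
  rcases eq_or_ne s 0 with rfl | h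
  · have h1 : Filter.Tendsto (fun s : ℝ => |s * log s|) (nhds 0) (nhds 0) := by
      simpa using (continuous_mul_log.abs.tendsto 0)
    have h2 : Filter.Tendsto (fun s : ℝ => arctan s * log s) (nhds 0) (nhds 0) := by
      refine squeeze_zero_norm (fun s => ?_) h1
      rw [norm_mul, abs_mul]
      exact mul_le_mul_of_nonneg_right (abs_arctan_le_abs s) (abs_nonneg _)
    simpa [ContinuousAt] using h2
  · exact continuous_arctan.continuousAt.mul (continuousAt_log h)

/-- The classical formula `Ti₂ (tan θ) = θ log (tan θ) + (Cl₂ (2θ) + Cl₂ (π - 2θ)) / 2`: both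
sides vanish at `0` and have the same derivative. -/
theorem invTanIntegral_eq {s : ℝ} (hs0 : 0 < s) (hs1 : s < 1) :
    invTanIntegral s = arctan s * log s +
      (clausen (2 * arctan s) + clausen (π - 2 * arctan s)) / 2 := by
  set H : ℝ → ℝ := fun s => invTanIntegral s - arctan s * log s -
    (clausen (2 * arctan s) + clausen (π - 2 * arctan s)) / 2 with hH
  have hcont : ContinuousOn H (Set.Icc 0 s) := by
    have h1 : ContinuousOn invTanIntegral (Set.Icc 0 s) :=
      continuousOn_invTanIntegral.mono (Set.Icc_subset_Icc (by norm_num) hs1.le)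
    have h2 : Continuous fun s => (clausen (2 * arctan s) + clausen (π - 2 * arctan s)) / 2 := by
      have := continuous_clausen
      fun_prop
    exact (h1.sub continuous_arctan_mul_log.continuousOn).sub h2.continuousOn
  have hderiv : ∀ x ∈ Set.Ioo 0 s, HasDerivAt H 0 x := by
    intro x hx
    have hx1 : |x| < 1 := by rw [abs_of_pos hx.1]; exact hx.2.trans hs1
    have hmem : 2 * arctan x ∈ Set.Ioo 0 π :=
      ⟨by linarith [arctan_pos.2 hx.1], by linarith [arctan_lt_pi_div_two x]⟩
    have h1 := hasDerivAt_invTanIntegral hx1 hx.1.ne'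
    have h2 := (hasDerivAt_arctan x).mul (hasDerivAt_log hx.1.ne')
    have h3 := (hasDerivAt_clausen_odd hmem).comp x ((hasDerivAt_arctan x).const_mul 2)
    refine ((h1.sub h2).sub h3).congr_deriv ?_
    rw [mul_div_cancel_left₀ _ (two_ne_zero' ℝ), tan_arctan]
    ring
  obtain ⟨c, -, hc⟩ := exists_hasDerivAt_eq_slope H (fun _ => 0) hs0 hcont hderiv
  have h0 : H 0 = 0 := by
    have hodd := (hasSum_clausen_odd 0).tsum_eq
    simp only [mul_zero, sin_zero, zero_div, tsum_zero] at hodd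
    simp only [hH, arctan_zero, zero_mul, mul_zero, ← hodd]
    simp [invTanIntegral]
  have hHs : H s = 0 := by
    rw [h0, sub_zero, sub_zero, eq_comm, div_eq_zero_iff] at hc
    exact hc.resolve_right hs0.ne'
  simp only [hH] at hHs
  linarith

/-! ### Integrals of `x ^ 2 * cos x` against a Poisson kernel -/

theorem poisson_denom_pos {q : ℝ} (hq : |q| < 1) (y : ℝ) : 0 < 1 - 2 * q * cos y + q ^ 2 := by
  have h1 : |q * cos y| ≤ |q| := by
    rw [abs_mul]; exact mul_le_of_le_one_right (abs_nonneg q) (abs_cos_le_one y)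
  have h2 : 0 < (1 - |q|) ^ 2 := by have : 0 < 1 - |q| := by linarith
                                    positivity
  nlinarith [le_abs_self (q * cos y), sq_abs q]

theorem hasSum_pow_mul_cos_odd {q : ℝ} (hq : |q| < 1) (x : ℝ) :
    HasSum (fun n : ℕ => q ^ n * cos ((2 * (n : ℝ) + 1) * x))
      ((1 - q) * cos x / (1 - 2 * q * cos (2 * x) + q ^ 2)) := by
  set f : ℕ → ℝ := fun n => q ^ n * cos ((2 * (n : ℝ) + 1) * x) with hf
  have hsum : Summable f := by
    refine Summable.of_norm_bounded (summable_geometric_of_abs_lt_one (r := |q|) (by simpa))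
      fun n => ?_
    rw [hf, norm_mul, norm_pow]
    exact mul_le_of_le_one_right (by positivity) (abs_cos_le_one _)
  obtain ⟨S, hS⟩ := hsum
  -- The terms satisfy the linear recurrence with characteristic polynomial
  -- `X ^ 2 - 2 q cos (2 x) X + q ^ 2`, which determines the sum.
  have hrec : ∀ n, f (n + 2) = 2 * q * cos (2 * x) * f (n + 1) - q ^ 2 * f n := by
    intro n
    have h1 : (2 * ((n + 2 : ℕ) : ℝ) + 1) * x = (2 * ((n + 1 : ℕ) : ℝ) + 1) * x + 2 * x := by
      push_cast; ring
    have h2 : (2 * (n : ℝ) + 1) * x = (2 * ((n + 1 : ℕ) : ℝ) + 1) * x - 2 * x := by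
      push_cast; ring
    simp only [hf]
    rw [h1, h2, cos_add, cos_sub]
    ring
  have hS1 : HasSum (fun n => f (n + 1)) (S - f 0) := by
    simpa using (hasSum_nat_add_iff' 1).2 hS
  have hS2 : HasSum (fun n => f (n + 2)) (S - (f 0 + f 1)) := by
    simpa [Finset.sum_range_succ] using (hasSum_nat_add_iff' 2).2 hS
  have hS2' := ((hS1.mul_left (2 * q * cos (2 * x))).sub (hS.mul_left (q ^ 2))).congr_fun hrec
  have heq := hS2.unique hS2'
  have h0 : f 0 = cos x := by simp [hf]
  have h1 : f 1 = q * (2 * cos (2 * x) - 1) * cos x := by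
    have h3 : (2 * ((1 : ℕ) : ℝ) + 1) * x = 3 * x := by push_cast; ring
    simp only [hf]
    rw [h3, cos_three_mul, cos_two_mul]
    ring
  rw [h0, h1] at heq
  rw [show (1 - q) * cos x / (1 - 2 * q * cos (2 * x) + q ^ 2) = S by
    rw [div_eq_iff (poisson_denom_pos hq _).ne']
    linear_combination -heq]
  exact hS

theorem integral_sq_mul_cos_odd (n : ℕ) :
    ∫ x in (0 : ℝ)..π, x ^ 2 * cos ((2 * (n : ℝ) + 1) * x) = -2 * π / (2 * (n : ℝ) + 1) ^ 2 := by
  set m : ℝ := 2 * (n : ℝ) + 1 with hm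
  have hm0 : m ≠ 0 := by positivity
  have hderiv : ∀ x ∈ Set.uIcc 0 π, HasDerivAt
      (fun x => x ^ 2 * sin (m * x) / m + 2 * x * cos (m * x) / m ^ 2 - 2 * sin (m * x) / m ^ 3)
      (x ^ 2 * cos (m * x)) x := by
    intro x _
    have hlin : HasDerivAt (fun x => m * x) m x := by simpa using (hasDerivAt_id x).const_mul m
    have h1 := ((hasDerivAt_pow 2 x).mul hlin.sin).div_const m
    have h2 := (((hasDerivAt_id x).const_mul 2).mul hlin.cos).div_const (m ^ 2)
    have h3 := (hlin.sin.const_mul 2).div_const (m ^ 3)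
    refine ((h1.add h2).sub h3).congr_deriv ?_
    simp only [id]
    field_simp
    ring
  rw [integral_eq_sub_of_hasDerivAt hderiv (Continuous.intervalIntegrable (by fun_prop) _ _)]
  have hmπ : m * π = ((2 * n + 1 : ℕ) : ℝ) * π := by rw [hm]; push_cast; ring
  have hsin : sin (m * π) = 0 := by rw [hmπ, sin_nat_mul_pi]
  have hcos : cos (m * π) = -1 := by rw [hmπ, cos_nat_mul_pi]; simp [pow_succ, pow_mul]
  rw [hsin, hcos]
  simp

/-- The integral is computed by expanding the kernel into a cosine series. -/
theorem hasSum_integral_sq_mul_cos_poisson {q : ℝ} (hq : |q| < 1) :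
    HasSum (fun n : ℕ => -2 * π * (q ^ n / (2 * (n : ℝ) + 1) ^ 2))
      ((1 - q) * ∫ x in (0 : ℝ)..π, x ^ 2 * cos x / (1 - 2 * q * cos (2 * x) + q ^ 2)) := by
  have hgeom := summable_geometric_of_abs_lt_one (r := |q|) (by simpa)
  have h := hasSum_integral_of_dominated_convergence (μ := volume) (a := 0) (b := π)
    (F := fun (n : ℕ) x => q ^ n * (x ^ 2 * cos ((2 * (n : ℝ) + 1) * x)))
    (f := fun x => (1 - q) * (x ^ 2 * cos x / (1 - 2 * q * cos (2 * x) + q ^ 2)))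
    (fun n x => |q| ^ n * x ^ 2)
    (fun n => Continuous.aestronglyMeasurable (by fun_prop))
    (fun n => .of_forall fun x _ => ?_)
    (.of_forall fun x _ => hgeom.mul_right _) ?_ (.of_forall fun x _ => ?_)
  · rw [intervalIntegral.integral_const_mul] at h
    refine h.congr_fun fun n => ?_
    rw [intervalIntegral.integral_const_mul, integral_sq_mul_cos_odd]
    ring
  · rw [norm_mul, norm_mul, norm_pow, norm_of_nonneg (sq_nonneg x)]
    gcongr
    · exact le_rfl
    · exact mul_le_of_le_one_right (sq_nonneg x) (abs_cos_le_one _)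
  · simp_rw [tsum_mul_right]
    exact Continuous.intervalIntegrable (by fun_prop) _ _
  · have h := (hasSum_pow_mul_cos_odd hq x).mul_left (x ^ 2)
    rw [show ∀ a b c d : ℝ, a * (b * c / d) = b * (a * c / d) from fun a b c d => by ring] at h
    exact h.congr_fun fun n => by ring

theorem integral_sq_mul_cos_poisson_sq {s : ℝ} (h0 : 0 < s) (h1 : s < 1) :
    ∫ x in (0 : ℝ)..π, x ^ 2 * cos x / (1 - 2 * s ^ 2 * cos (2 * x) + (s ^ 2) ^ 2) =
      -π * (dilog s - dilog (-s)) / (s * (1 - s ^ 2)) := by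
  have hq : s ^ 2 < 1 := pow_lt_one₀ h0.le h1 two_ne_zero
  have h := hasSum_integral_sq_mul_cos_poisson (q := s ^ 2) (by rwa [abs_of_pos (by positivity)])
  have h' := ((hasSum_dilog_odd (abs_le.2 ⟨by linarith, h1.le⟩)).mul_left (-2 * π / s)).congr_fun
    (g := fun n : ℕ => -2 * π * ((s ^ 2) ^ n / (2 * (n : ℝ) + 1) ^ 2)) fun n => by
      rw [pow_succ s (2 * n), pow_mul]; field_simp
  have heq := h.unique h'
  have hne : 1 - s ^ 2 ≠ 0 := by linarith
  rw [eq_div_iff (by positivity)]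
  calc _ = s * ((1 - s ^ 2) * _) := by ring
    _ = _ := by rw [heq]; field_simp

theorem integral_sq_mul_cos_poisson_neg_sq {s : ℝ} (h0 : 0 < s) (h1 : s < 1) :
    ∫ x in (0 : ℝ)..π, x ^ 2 * cos x / (1 + 2 * s ^ 2 * cos (2 * x) + (s ^ 2) ^ 2) =
      -2 * π * invTanIntegral s / (s * (1 + s ^ 2)) := by
  have hq : s ^ 2 < 1 := pow_lt_one₀ h0.le h1 two_ne_zero
  have h := hasSum_integral_sq_mul_cos_poisson (q := -s ^ 2)
    (by rwa [abs_neg, abs_of_pos (by positivity)])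
  have heq := h.tsum_eq
  have hterm : ∀ n : ℕ, -2 * π * ((-s ^ 2) ^ n / (2 * (n : ℝ) + 1) ^ 2) =
      -2 * π / s * ((-1) ^ n * s ^ (2 * n + 1) / (2 * (n : ℝ) + 1) ^ 2) := by
    intro n
    rw [pow_succ s (2 * n), pow_mul, neg_pow (s ^ 2)]; field_simp
  simp_rw [hterm, tsum_mul_left] at heq
  change -2 * π / s * invTanIntegral s = _ at heq
  have hden : ∀ x, 1 - 2 * -s ^ 2 * cos (2 * x) + (-s ^ 2) ^ 2 =
      1 + 2 * s ^ 2 * cos (2 * x) + (s ^ 2) ^ 2 := fun x => by ring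
  simp_rw [hden] at heq
  rw [eq_div_iff (by positivity)]
  calc _ = s * ((1 - -s ^ 2) * _) := by ring
    _ = _ := by rw [← heq]; field_simp

/-! ### Lucas numbers -/

theorem lucas_eq (n : ℕ) :
    (lucas n : ℝ) = ((1 + √5) / 2) ^ n + ((1 - √5) / 2) ^ n ∧
    (lucas (n + 1) : ℝ) = ((1 + √5) / 2) ^ (n + 1) + ((1 - √5) / 2) ^ (n + 1) := by
  have h5 : √5 ^ 2 = 5 := sq_sqrt (by norm_num)
  induction n with
  | zero => constructor <;> simp [lucas]; ring
  | succ n ih =>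
    refine ⟨ih.2, ?_⟩
    rw [lucas, Nat.cast_add, ih.1, ih.2]
    linear_combination (-(((1 + √5) / 2) ^ n + ((1 - √5) / 2) ^ n) / 4) * h5

theorem lucas_eq_add_inv {r : ℕ} (h : Even r) :
    (lucas r : ℝ) = ((1 - √5) / 2) ^ r + (((1 - √5) / 2) ^ r)⁻¹ := by
  have h5 : √5 ^ 2 = 5 := sq_sqrt (by norm_num)
  have hprod : ((1 + √5) / 2) ^ r * ((1 - √5) / 2) ^ r = 1 := by
    rw [← mul_pow, show (1 + √5) / 2 * ((1 - √5) / 2) = -1 by linear_combination -h5 / 4,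
      h.neg_one_pow]
  rw [(lucas_eq r).1, eq_inv_of_mul_eq_one_left hprod, add_comm]

/-! ### The two integrals -/

theorem theorem51 (r : ℕ) (hr : 0 < r) (heven : Even r)
    (L β s : ℝ) (hL : L = (lucas r : ℝ)) (hβ : β = (1 - √5) / 2) (hs : s = √(β ^ r)) :
    (IntervalIntegrable (fun x : ℝ => x ^ 2 * cos x / (L ^ 2 - 4 * cos (2 * x) ^ 2))
        volume 0 π ∧
      ∫ x in (0 : ℝ)..π, x ^ 2 * cos x / (L ^ 2 - 4 * cos (2 * x) ^ 2) =
        -(π / (2 * L)) * (s / (1 - β ^ r)) * (dilog s - dilog (-s))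
        - π / (2 * L) * (s / (1 + β ^ r))
            * (clausen (2 * arctan s) + clausen (π - 2 * arctan s))
        - π / L * (s / (1 + β ^ r)) * arctan s * log s) ∧
    (IntervalIntegrable (fun x : ℝ => x ^ 2 * cos (3 * x) / (L ^ 2 - 4 * cos (2 * x) ^ 2))
        volume 0 π ∧
      ∫ x in (0 : ℝ)..π, x ^ 2 * cos (3 * x) / (L ^ 2 - 4 * cos (2 * x) ^ 2) =
        (1 / L - 1) * (π / 2) * (s / (1 - β ^ r)) * (dilog s - dilog (-s))
        + (1 / L + 1) * (π / 2) * (s / (1 + β ^ r))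
            * (clausen (2 * arctan s) + clausen (π - 2 * arctan s))
        + (1 / L + 1) * (π * s / (1 + β ^ r)) * arctan s * log s) := by
  have h5 : √5 ^ 2 = 5 := sq_sqrt (by norm_num)
  have h5pos := sqrt_nonneg 5
  have hβne : β ≠ 0 := by
    rintro rfl
    nlinarith
  have hβabs : |β| < 1 := by
    rw [hβ, abs_lt]
    constructor <;> nlinarith
  have hq0 : 0 < β ^ r := heven.pow_pos hβne
  have hq1 : β ^ r < 1 := by
    rw [← heven.pow_abs]
    exact pow_lt_one₀ (abs_nonneg β) hβabs hr.ne'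
  have hs0 : 0 < s := by rw [hs]; exact sqrt_pos.2 hq0
  have hs1 : s < 1 := by rw [hs, sqrt_lt' one_pos]; simpa using hq1
  have hsq : β ^ r = s ^ 2 := by rw [hs, sq_sqrt hq0.le]
  have hLs : L = s ^ 2 + (s ^ 2)⁻¹ := by rw [hL, lucas_eq_add_inv heven, ← hβ, hsq]
  rw [hsq]
  rw [hsq] at hq1
  have hL0 : 0 < L := by rw [hLs]; positivity
  have hLmul : L * s ^ 2 = 1 + (s ^ 2) ^ 2 := by rw [hLs]; field_simp; ring
  set P : ℝ → ℝ := fun x => 1 - 2 * s ^ 2 * cos (2 * x) + (s ^ 2) ^ 2 with hP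
  set N : ℝ → ℝ := fun x => 1 + 2 * s ^ 2 * cos (2 * x) + (s ^ 2) ^ 2 with hN
  have hPpos : ∀ x, 0 < P x := fun x =>
    poisson_denom_pos (by rwa [abs_of_pos (by positivity)]) _
  have hNpos : ∀ x, 0 < N x := fun x => by
    have := poisson_denom_pos (q := -s ^ 2) (by rwa [abs_neg, abs_of_pos (by positivity)]) (2 * x)
    simp only [hN]; linarith
  have hden : ∀ x, L ^ 2 - 4 * cos (2 * x) ^ 2 = P x * N x / s ^ 4 := by
    intro x
    rw [eq_div_iff (by positivity)]
    simp only [hP, hN]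
    linear_combination (L * s ^ 2 + 1 + (s ^ 2) ^ 2) * hLmul
  have hPc : Continuous P := by fun_prop
  have hNc : Continuous N := by fun_prop
  have hPi : IntervalIntegrable (fun x => x ^ 2 * cos x / P x) volume 0 π :=
    (Continuous.div (by fun_prop) hPc fun x => (hPpos x).ne').intervalIntegrable _ _
  have hNi : IntervalIntegrable (fun x => x ^ 2 * cos x / N x) volume 0 π :=
    (Continuous.div (by fun_prop) hNc fun x => (hNpos x).ne').intervalIntegrable _ _
  -- Partial fractions, with `P = s ^ 2 * (L - 2 cos 2x)` and `N = s ^ 2 * (L + 2 cos 2x)`;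
  -- the second one uses `cos 3x = (2 cos 2x - 1) cos x`.
  have hfun1 : (fun x : ℝ => x ^ 2 * cos x / (L ^ 2 - 4 * cos (2 * x) ^ 2)) = fun x =>
      s ^ 2 / (2 * L) * (x ^ 2 * cos x / P x) + s ^ 2 / (2 * L) * (x ^ 2 * cos x / N x) := by
    ext x
    have hp := (hPpos x).ne'
    have hn := (hNpos x).ne'
    have hadd : P x + N x = 2 * (L * s ^ 2) := by simp only [hP, hN]; rw [hLmul]; ring
    rw [hden]
    field_simp
    linear_combination -(x ^ 2 * cos x) * hadd
  have hfun2 : (fun x : ℝ => x ^ 2 * cos (3 * x) / (L ^ 2 - 4 * cos (2 * x) ^ 2)) = fun x =>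
      s ^ 2 / 2 * (1 - 1 / L) * (x ^ 2 * cos x / P x)
        - s ^ 2 / 2 * (1 + 1 / L) * (x ^ 2 * cos x / N x) := by
    ext x
    have hp := (hPpos x).ne'
    have hn := (hNpos x).ne'
    have hadd : P x + N x = 2 * (L * s ^ 2) := by simp only [hP, hN]; rw [hLmul]; ring
    have hsub : N x - P x = 4 * s ^ 2 * cos (2 * x) := by simp only [hP, hN]; ring
    have hcos : cos (3 * x) = (2 * cos (2 * x) - 1) * cos x := by
      rw [cos_three_mul, cos_two_mul]; ring
    rw [hden, hcos]
    generalize cos (2 * x) = c at hsub ⊢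
    field_simp
    linear_combination (x ^ 2 * cos x) * (hadd - L * hsub)
  have hI := integral_sq_mul_cos_poisson_sq hs0 hs1
  have hJ := integral_sq_mul_cos_poisson_neg_sq hs0 hs1
  rw [invTanIntegral_eq hs0 hs1] at hJ
  have hne : 1 - s ^ 2 ≠ 0 := by linarith
  rw [hfun1, hfun2]
  refine ⟨⟨(hPi.const_mul _).add (hNi.const_mul _), ?_⟩,
    (hPi.const_mul _).sub (hNi.const_mul _), ?_⟩
  · rw [intervalIntegral.integral_add (hPi.const_mul _) (hNi.const_mul _),
      intervalIntegral.integral_const_mul,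
      intervalIntegral.integral_const_mul, hI, hJ]
    field_simp
    ring
  · rw [intervalIntegral.integral_sub (hPi.const_mul _) (hNi.const_mul _),
      intervalIntegral.integral_const_mul,
      intervalIntegral.integral_const_mul, hI, hJ]
    field_simp
    ring
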